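/- Let $M,N\ge 1$, $\mathbf X=[M]$, $\mathbf Y=[N]$. A database is a partial function $D$ from $\mathbf X$ to $\mathbf Y$ (with $D(x)=\bot$ if $x$ is not in $D$), and $|D|$ is the number of its entries. A property $P$ is a set of databases; it is monotone if $D\in P$ and $D\subseteq D'$ imply $D'\in P$. Assume $\emptyset\notin P$. The transition probability of $P$ is $$p_\nu=\max_{D\notin P,\ |D|\le \nu,\ D(x)=\bot}\ \Pr_{y\leftarrow \mathbf Y}\big[D\cup\{(x,y)\}\in P\big].$$ For $\kappa\ge 1$ consider databases on $[\kappa]\times\mathbf X$, with restrictions $D|_k=\{(x,y):((k,x),y)\in D\}$, and let $P^{\times\kappa}=\{D : D|_k\in P \text{ for all } k\in[\kappa]\}$. Let $\omega_N=e^{2\pi i/N}$. One query to the compressed phase oracle is $\mathsf{cO}=\mathsf{StdDecomp}\cdot\mathsf{CPhsO}'\cdot\mathsf{StdDecomp}$ on basis states $|(k,x),u,w\rangle|D\rangle$ ($u\in\{0,\dots,N-1\}$, outputs also numbered $0,\dots,N-1$, $w$ in a finite work register). Here $\mathsf{CPhsO}'$ multiplies the basis state by $\omega_N^{u\cdot D(k,x)}$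 (by $1$ if $D(k,x)=\bot$). The unitary $\mathsf{StdDecomp}$ acts on the database entry at the queried input $(k,x)$: it swaps $|\bot\rangle$ with $\frac1{\sqrt N}\sum_y|y\rangle$ and is the identity on the orthogonal complement of these two vectors. A $q$-query quantum algorithm starts in $|\psi_0\rangle\otimes|\emptyset\rangle$ for a unit vector $\psi_0$ of its own registers and applies $U_1,\mathsf{cO},U_2,\mathsf{cO},\dots,U_q,\mathsf{cO},U_{\sf final}$, where the $U_i$ and $U_{\sf final}$ are arbitrary unitaries on its own registers. It finds $P^{\times\kappa}$ with probability $\|(\mathbb I\otimes\sum_{D\in P^{\times\kappa}}|D\rangle\langle D|)\,|\psi\rangle\|^2$, where $|\psi\rangle$ is the final joint state. Theorem. For all $c_1,c_2\ge 0$, all $a,b,g_1,g_2>0$ and all $t_0\in\mathbb N$ there is a constant $C>0$, depending only on these, such that the following holds for all $M,N\ge 1$ and all monotone $P$ with $\emptyset\notin P$. Suppose that $p_t=\Theta(t^{c_1}/N^{c_2})$ in the sense that $$a\cdot\min\{1,\,t^{c_1}/N^{c_2}\}\ \le\ p_t\ \le\ b\cdot t^{c_1}/N^{c_2}\qquad\text{for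 all integers } t \text{ with } t_0\le t<M .$$ Let $\kappa\ge 1$ and $T\ge t_0$ be integers and let $\gamma_T=\Theta(T^2p_T)$, that is, $g_1T^2p_T\le\gamma_T\le g_2T^2p_T$. Then every quantum algorithm making $\kappa T$ queries to the compressed oracle finds $P^{\times\kappa}$ with probability at most $C^\kappa\cdot\gamma_T^\kappa$. -/

import Mathlib

noncomputable section

namespace CompressedOracle

/-! ### Databases and properties of databases -/

/-- A database with inputs in `X` and outputs in `Y`: the entry at `x` is `none` (the symbol `⊥`)
when `x` does not occur in the database. -/
abbrev Database (X Y : Type*) := X → Option Y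

/-- The empty database. -/
def emptyDB (X Y : Type*) : Database X Y := fun _ => none

/-- The number of entries different from `⊥`. -/
def size {X Y : Type*} [Fintype X] (D : Database X Y) : ℕ :=
  (Finset.univ.filter fun x => (D x).isSome = true).card

/-- The inclusion `D ⊆ D'`. -/
def Contained {X Y : Type*} (D D' : Database X Y) : Prop :=
  ∀ x y, D x = some y → D' x = some y

/-- A property `P` is monotone when it passes to larger databases. -/
def IsMonotone {X Y : Type*} (P : Set (Database X Y)) : Prop :=
  ∀ D D' : Database X Y, D ∈ P → Contained D D' → D' ∈ P

/-- The transition probability: the maximum, over databases `D ∉ P` of size at most `ν` and inputs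
`x` not in `D`, of the probability over a uniform `y` that `D ∪ {(x, y)} ∈ P`.
The set of values is finite, so that the supremum is a maximum as soon as the set is nonempty. -/
def transitionProb {X Y : Type*} [Fintype X] [DecidableEq X] [Fintype Y]
    (P : Set (Database X Y)) (ν : ℕ) : ℝ :=
  sSup {r : ℝ | ∃ (D : Database X Y) (x : X), D ∉ P ∧ size D ≤ ν ∧ D x = none ∧
    r = (Set.ncard {y : Y | Function.update D x (some y) ∈ P} : ℝ) / (Fintype.card Y : ℝ)}

/-- `p_t = Θ(t ^ c₁ / N ^ c₂)` with implied constants `a`, `b`, for all `t ≥ t₀`. Only `t < M` is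
constrained, since a database that misses an input has size less than `M`; the
lower bound is capped at `1`, since `p_t` is a probability. -/
def IsPolynomial {M N : ℕ} (P : Set (Database (Fin M) (Fin N))) (c₁ c₂ a b : ℝ) (t₀ : ℕ) : Prop :=
  ∀ t : ℕ, t₀ ≤ t → t < M →
    a * min 1 ((t : ℝ) ^ c₁ / (N : ℝ) ^ c₂) ≤ transitionProb P t ∧
      transitionProb P t ≤ b * ((t : ℝ) ^ c₁ / (N : ℝ) ^ c₂)

/-- The restriction `D|_k` of a database on salted inputs to the salt `k`. -/
def restrict {K X Y : Type*} (D : Database (K × X) Y) (k : K) : Database X Y :=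
  fun x => D (k, x)

/-- The direct product property: the restriction to each of the `κ` salts has property `P`. -/
def directProduct {X Y : Type*} (κ : ℕ) (P : Set (Database X Y)) :
    Set (Database (Fin κ × X) Y) :=
  {D | ∀ k : Fin κ, restrict D k ∈ P}

/-! ### The compressed phase oracle -/

/-- Computational basis `|x, u, w⟩` of the algorithm's registers. -/
abbrev AlgBasis (X : Type*) (N : ℕ) (W : Type*) := X × Fin N × W

/-- Computational basis `|x, u, w⟩ ⊗ |D⟩` of the joint system. -/
abbrev JointBasis (X : Type*) (N : ℕ) (W : Type*) := AlgBasis X N W × Database X (Fin N)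

/-- Vectors of the joint system; `ψ (a, D)` is the amplitude of `|a⟩ ⊗ |D⟩`. -/
abbrev State (X : Type*) (N : ℕ) (W : Type*) := EuclideanSpace ℂ (JointBasis X N W)

/-- Matrix entries `⟨o| S |o'⟩` of the unitary on `ℂ^[N] ⊕ ℂ|⊥⟩` that swaps `|⊥⟩` with the
uniform superposition `N^{-1/2} ∑ |y⟩` and is the identity on the orthogonal complement of both. -/
def decompEntry (N : ℕ) : Option (Fin N) → Option (Fin N) → ℂ
  | none, none => 0
  | none, some _ => 1 / (Real.sqrt N : ℂ)
  | some _, none => 1 / (Real.sqrt N : ℂ)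
  | some y, some y' => (if y = y' then 1 else 0) - 1 / (N : ℂ)

/-- `StdDecomp`: the above unitary on the database register at the queried input `x`. -/
def stdDecomp {X W : Type*} {N : ℕ} [DecidableEq X] (ψ : State X N W) : State X N W :=
  WithLp.toLp 2 fun s => ∑ o : Option (Fin N),
    decompEntry N (s.2 s.1.1) o * ψ (s.1, Function.update s.2 s.1.1 o)

/-- The phase `ω_N ^ (u * y)`, `ω_N = exp (2 π i / N)`, for a defined value `y`; no phase for `⊥`. -/
def phase {N : ℕ} (u : Fin N) : Option (Fin N) → ℂ
  | none => 1
  | some y => Complex.exp (2 * Real.pi * Complex.I / (N : ℂ)) ^ ((u : ℕ) * (y : ℕ))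

/-- `CPhsO' |x, u, w⟩|D⟩ = ω_N ^ (u * D(x)) |x, u, w⟩|D⟩`. -/
def phaseQuery {X W : Type*} {N : ℕ} (ψ : State X N W) : State X N W :=
  WithLp.toLp 2 fun s => phase s.1.2.1 (s.2 s.1.1) * ψ s

/-- One query to the compressed phase oracle, `CPhsO = StdDecomp ∘ CPhsO' ∘ StdDecomp`. -/
def oracleQuery {X W : Type*} {N : ℕ} [DecidableEq X] (ψ : State X N W) : State X N W :=
  stdDecomp (phaseQuery (stdDecomp ψ))

/-! ### Query algorithms -/

/-- A quantum query algorithm with work register `W`: an initial unit vector of its registers, the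
local unitary `localU i` applied before the query number `i + 1`, and a last local unitary. When
`q` queries are made, only `localU 0, …, localU (q - 1)` are used. -/
structure QueryAlgorithm (X : Type*) (N : ℕ) (W : Type*)
    [Fintype X] [DecidableEq X] [Fintype W] [DecidableEq W] where
  init : EuclideanSpace ℂ (AlgBasis X N W)
  norm_init : ‖init‖ = 1
  localU : ℕ → Matrix.unitaryGroup (AlgBasis X N W) ℂ
  finalU : Matrix.unitaryGroup (AlgBasis X N W) ℂ

section

variable {X W : Type*} {N : ℕ} [Fintype X] [DecidableEq X] [Fintype W] [DecidableEq W]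

/-- `U ⊗ 𝕀`: a local unitary acts on the algorithm's registers only. -/
def applyLocal (U : Matrix.unitaryGroup (AlgBasis X N W) ℂ) (ψ : State X N W) : State X N W :=
  WithLp.toLp 2 fun s => ∑ a : AlgBasis X N W,
    (U : Matrix (AlgBasis X N W) (AlgBasis X N W) ℂ) s.1 a * ψ (a, s.2)

/-- The initial joint state: the algorithm's initial state tensored with the empty database. -/
def initialState (A : QueryAlgorithm X N W) : State X N W :=
  WithLp.toLp 2 fun s => if s.2 = emptyDB X (Fin N) then A.init s.1 else 0

/-- The joint state after `q` queries. -/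
def stateAfter (A : QueryAlgorithm X N W) : ℕ → State X N W
  | 0 => initialState A
  | q + 1 => oracleQuery (applyLocal (A.localU q) (stateAfter A q))

open Classical in
/-- `𝕀 ⊗ Λ_Q`: the projection onto the databases with property `Q`. -/
def project (Q : Set (Database X (Fin N))) (ψ : State X N W) : State X N W :=
  WithLp.toLp 2 fun s => if s.2 ∈ Q then ψ s else 0

/-- The probability that the algorithm, making `q` queries to the compressed oracle, finds the
property `Q`: the measurement `{Λ_Q, 𝕀 - Λ_Q}` of the database has the outcome `Λ_Q`. -/
def winProb (A : QueryAlgorithm X N W) (q : ℕ) (Q : Set (Database X (Fin N))) : ℝ :=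
  ‖project Q (applyLocal A.finalU (stateAfter A q))‖ ^ 2

end

end CompressedOracle

end

noncomputable section

namespace CompressedOracle

/-! ### The oracle on a single database entry -/

/-! The proof follows a weighted norm of the joint state. A database gets the product over the salts
of the weight `saltWeight`, which is `L` on `P` and `min (exp (|D| / T)) L` elsewhere, with `L ^ 2`
of order `1 / (T ^ 2 * p_T)`. The energy starts at most `1`, and local unitaries preserve it since
the weight sees only the database.

One query touches one entry, hence one factor of the product. Amplitude reaches a set of a fraction
`p` of the new values with a coefficient of order `√p` (`norm_entryQuery_some_sq_le`). If `√(8 * p)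
* L ≤ f / T`, where `f` is the weight before the jump, the weighted norm grows by at most `1 + 1 /
T` (`two_weight_entryQuery_le`), apart from the factor `exp (1 / T)` for a larger database. Over `κ
* T` queries the energy thus gains at most `exp 4 ^ κ`. Success forces the weight `L ^ κ`, and
division by its square gives the bound (`winProb_directProduct_le`).

The queries may be spread unevenly over the salts, so a single restriction may outgrow `T`. The
exponential weight pays for this: beyond `T` the transition probability grows polynomially in `|D| /
T`, so it is at most a constant times `p_T * exp (2 * |D| / T)` (`IsPolynomial.ncard_div_le`). -/

/-- The decomposition unitary on a single database entry. -/
def entryDecomp {N : ℕ} (φ : Option (Fin N) → ℂ) (o : Option (Fin N)) : ℂ :=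
  ∑ o', decompEntry N o o' * φ o'

/-- The overlap of an entry with `|⊥⟩ - N^{-1/2} ∑ |y⟩`, the vector that `entryDecomp` reflects. -/
def entryOverlap {N : ℕ} (φ : Option (Fin N) → ℂ) : ℂ :=
  φ none - 1 / (Real.sqrt N : ℂ) * ∑ y, φ (some y)

/-- The compressed phase oracle on a single database entry. -/
def entryQuery {N : ℕ} (u : Fin N) (φ : Option (Fin N) → ℂ) : Option (Fin N) → ℂ :=
  entryDecomp fun o => phase u o * entryDecomp φ o

lemma entryDecomp_none {N : ℕ} (φ : Option (Fin N) → ℂ) :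
    entryDecomp φ none = φ none - entryOverlap φ := by
  simp [entryDecomp, entryOverlap, Fintype.sum_option, decompEntry, Finset.mul_sum]

lemma ofReal_sqrt_mul_self (N : ℕ) : (Real.sqrt N : ℂ) * (Real.sqrt N : ℂ) = N := by
  rw [← Complex.ofReal_mul, Real.mul_self_sqrt (Nat.cast_nonneg N)]
  simp

lemma entryDecomp_some {N : ℕ} (φ : Option (Fin N) → ℂ) (y : Fin N) :
    entryDecomp φ (some y) = φ (some y) + 1 / (Real.sqrt N : ℂ) * entryOverlap φ := by
  have h : (1 : ℂ) / N = 1 / (Real.sqrt N : ℂ) * (1 / (Real.sqrt N : ℂ)) := by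
    rw [← ofReal_sqrt_mul_self N, div_mul_div_comm, one_mul]
  simp only [entryDecomp, entryOverlap, Fintype.sum_option, decompEntry, h, sub_mul,
    Finset.sum_sub_distrib, ite_mul, one_mul, zero_mul, Finset.sum_ite_eq, Finset.mem_univ, if_true,
    ← Finset.mul_sum]
  ring

/-- Cauchy–Schwarz: the reflected vector has squared norm `2`. -/
lemma norm_entryOverlap_sq_le {N : ℕ} (hN : 0 < N) (φ : Option (Fin N) → ℂ) :
    ‖entryOverlap φ‖ ^ 2 ≤ 2 * ∑ o, ‖φ o‖ ^ 2 := by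
  have hN' : (0 : ℝ) < N := by exact_mod_cast hN
  have h1 : ‖1 / (Real.sqrt N : ℂ) * ∑ y, φ (some y)‖ ^ 2 ≤ ∑ y, ‖φ (some y)‖ ^ 2 := by
    have h2 : ‖∑ y, φ (some y)‖ ^ 2 ≤ N * ∑ y, ‖φ (some y)‖ ^ 2 := by
      calc ‖∑ y, φ (some y)‖ ^ 2 ≤ (∑ y, ‖φ (some y)‖) ^ 2 := by
            gcongr; exact norm_sum_le _ _
        _ ≤ _ := by
            simpa using sq_sum_le_card_mul_sum_sq (s := Finset.univ) (f := fun y => ‖φ (some y)‖)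
    have h3 : ‖1 / (Real.sqrt N : ℂ)‖ ^ 2 = 1 / N := by
      rw [norm_div, norm_one, Complex.norm_real, Real.norm_of_nonneg (Real.sqrt_nonneg _), div_pow,
        Real.sq_sqrt hN'.le, one_pow]
    rw [norm_mul, mul_pow, h3, one_div, inv_mul_le_iff₀ hN']
    exact h2
  rw [Fintype.sum_option]
  have h4 := norm_sub_le (φ none) (1 / (Real.sqrt N : ℂ) * ∑ y, φ (some y))
  rw [entryOverlap]
  nlinarith [norm_nonneg (φ none - 1 / (Real.sqrt N : ℂ) * ∑ y, φ (some y)),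
    sq_nonneg (‖φ none‖ - ‖1 / (Real.sqrt N : ℂ) * ∑ y, φ (some y)‖),
    pow_le_pow_left₀ (norm_nonneg _) h4 2]

/-- Since the vector `v` has squared norm `2`, subtracting the overlap times `v` is exactly the
reflection in its orthogonal complement. -/
lemma sum_norm_entryDecomp_sq {N : ℕ} (hN : 0 < N) (φ : Option (Fin N) → ℂ) :
    ∑ o, ‖entryDecomp φ o‖ ^ 2 = ∑ o, ‖φ o‖ ^ 2 := by
  have hN' : (0 : ℝ) < N := by exact_mod_cast hN
  set s : ℝ := 1 / Real.sqrt N with hs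
  have hs2 : N * s ^ 2 = 1 := by
    rw [hs, div_pow, Real.sq_sqrt hN'.le]; field_simp
  have hsc : (1 : ℂ) / (Real.sqrt N : ℂ) = (s : ℂ) := by simp [hs]
  have hα : entryOverlap φ = φ none - s * ∑ y, φ (some y) := by rw [entryOverlap, hsc]
  simp only [Fintype.sum_option, entryDecomp_none, entryDecomp_some, hsc]
  set α := entryOverlap φ
  have hre : α.re = (φ none).re - s * ∑ y, (φ (some y)).re := by rw [hα]; simp
  have him : α.im = (φ none).im - s * ∑ y, (φ (some y)).im := by rw [hα]; simp
  simp only [← Complex.normSq_eq_norm_sq, Complex.normSq_apply, Complex.sub_re, Complex.sub_im,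
    Complex.add_re, Complex.add_im, Complex.re_ofReal_mul, Complex.im_ofReal_mul]
  have h : ∑ y, (((φ (some y)).re + s * α.re) * ((φ (some y)).re + s * α.re) +
      ((φ (some y)).im + s * α.im) * ((φ (some y)).im + s * α.im)) =
      ∑ y, ((φ (some y)).re * (φ (some y)).re + (φ (some y)).im * (φ (some y)).im) +
      2 * α.re * (s * ∑ y, (φ (some y)).re) + 2 * α.im * (s * ∑ y, (φ (some y)).im) +
      N * s ^ 2 * (α.re ^ 2 + α.im ^ 2) := by
    have : (N : ℝ) * s ^ 2 * (α.re ^ 2 + α.im ^ 2) =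
        ∑ _y : Fin N, s ^ 2 * (α.re ^ 2 + α.im ^ 2) := by simp; ring
    rw [this]
    simp only [Finset.mul_sum, ← Finset.sum_add_distrib]
    exact Finset.sum_congr rfl fun y _ => by ring
  rw [h, hs2]
  have h1 : s * ∑ y, (φ (some y)).re = (φ none).re - α.re := by linarith
  have h2 : s * ∑ y, (φ (some y)).im = (φ none).im - α.im := by linarith
  rw [h1, h2]
  ring

lemma norm_phase {N : ℕ} (u : Fin N) (o : Option (Fin N)) : ‖phase u o‖ = 1 := by
  cases o with
  | none => simp [phase]
  | some y =>
    have h : (2 * Real.pi * Complex.I / (N : ℂ)) = ((2 * Real.pi / N : ℝ) : ℂ) * Complex.I := by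
      push_cast; ring
    simp only [phase, norm_pow]
    rw [h, Complex.norm_exp_ofReal_mul_I, one_pow]

lemma sum_norm_phase_mul_sq {N : ℕ} (u : Fin N) (φ : Option (Fin N) → ℂ) :
    ∑ o, ‖phase u o * φ o‖ ^ 2 = ∑ o, ‖φ o‖ ^ 2 := by
  simp [norm_phase]

lemma sum_norm_entryQuery_sq {N : ℕ} (hN : 0 < N) (u : Fin N) (φ : Option (Fin N) → ℂ) :
    ∑ o, ‖entryQuery u φ o‖ ^ 2 = ∑ o, ‖φ o‖ ^ 2 := by
  rw [entryQuery, sum_norm_entryDecomp_sq hN, sum_norm_phase_mul_sq, sum_norm_entryDecomp_sq hN]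

lemma entryQuery_add {N : ℕ} (u : Fin N) (φ χ : Option (Fin N) → ℂ) (o : Option (Fin N)) :
    entryQuery u (fun o => φ o + χ o) o = entryQuery u φ o + entryQuery u χ o := by
  simp only [entryQuery, entryDecomp, mul_add, Finset.sum_add_distrib]

/-- At a value without initial amplitude, only the two reflections contribute, each with its overlap
divided by `√N`. Both squared overlaps are at most twice the total weight, whence `8 = 2 * (2 + 2)`.
-/
lemma norm_entryQuery_some_sq_le {N : ℕ} (hN : 0 < N) (u : Fin N) (φ : Option (Fin N) → ℂ)
    (y : Fin N) (hy : φ (some y) = 0) :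
    ‖entryQuery u φ (some y)‖ ^ 2 ≤ 8 / N * ∑ o, ‖φ o‖ ^ 2 := by
  have hN' : (0 : ℝ) < N := by exact_mod_cast hN
  have h1 := norm_entryOverlap_sq_le hN φ
  have h2 := norm_entryOverlap_sq_le hN fun o => phase u o * entryDecomp φ o
  rw [sum_norm_phase_mul_sq, sum_norm_entryDecomp_sq hN] at h2
  rw [entryQuery, entryDecomp_some, entryDecomp_some, hy, zero_add]
  generalize entryOverlap (fun o => phase u o * entryDecomp φ o) = β at *
  generalize entryOverlap φ = α at *
  have h3 : ‖phase u (some y) * (1 / (Real.sqrt N : ℂ) * α) + 1 / (Real.sqrt N : ℂ) * β‖ ≤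
      1 / Real.sqrt N * (‖α‖ + ‖β‖) := by
    refine (norm_add_le _ _).trans (le_of_eq ?_)
    simp only [norm_mul, norm_phase, norm_div, norm_one, Complex.norm_real,
      Real.norm_of_nonneg (Real.sqrt_nonneg _)]
    ring
  calc _ ≤ (1 / Real.sqrt N * (‖α‖ + ‖β‖)) ^ 2 := by gcongr
    _ = 1 / N * (‖α‖ + ‖β‖) ^ 2 := by
      rw [mul_pow, div_pow, Real.sq_sqrt hN'.le, one_pow]
    _ ≤ 1 / N * (8 * ∑ o, ‖φ o‖ ^ 2) := by
      gcongr
      nlinarith [sq_nonneg (‖α‖ - ‖β‖)]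
    _ = _ := by ring

lemma sum_ite_norm_entryQuery_sq_le {N : ℕ} (hN : 0 < N) (u : Fin N) (φ : Option (Fin N) → ℂ)
    (S : Finset (Fin N)) (hφ : ∀ y ∈ S, φ (some y) = 0) :
    ∑ y ∈ S, ‖entryQuery u φ (some y)‖ ^ 2 ≤ 8 * (S.card / N) * ∑ o, ‖φ o‖ ^ 2 := by
  refine (Finset.sum_le_card_nsmul S _ _ fun y hy =>
    norm_entryQuery_some_sq_le hN u φ y (hφ y hy)).trans (le_of_eq ?_)
  rw [nsmul_eq_mul]; ring

/-- Minkowski's inequality for finite sums of squares. -/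
lemma sqrt_sum_norm_add_sq_le {ι : Type*} (S : Finset ι) (f g : ι → ℂ) :
    √(∑ i ∈ S, ‖f i + g i‖ ^ 2) ≤ √(∑ i ∈ S, ‖f i‖ ^ 2) + √(∑ i ∈ S, ‖g i‖ ^ 2) := by
  have h := norm_add_le (WithLp.toLp 2 fun i : S => f i : EuclideanSpace ℂ S)
    (WithLp.toLp 2 fun i : S => g i)
  simp only [EuclideanSpace.norm_eq, PiLp.add_apply] at h
  simpa only [Finset.sum_coe_sort S fun i => ‖f i + g i‖ ^ 2,
    Finset.sum_coe_sort S fun i => ‖f i‖ ^ 2, Finset.sum_coe_sort S fun i => ‖g i‖ ^ 2] using h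

/-- The weight of the entries in `S` grows by little, when these weigh `L` and the others `f`. -/
lemma two_weight_entryQuery_le {N : ℕ} (hN : 0 < N) (u : Fin N) (φ : Option (Fin N) → ℂ)
    (S : Finset (Fin N)) {f L δ : ℝ} (hf : 0 < f) (hfL : f ≤ L) (hδ : 0 ≤ δ)
    (hS : 8 * (S.card / N) * L ^ 2 ≤ δ ^ 2 * f ^ 2) :
    f ^ 2 * ∑ o, ‖entryQuery u φ o‖ ^ 2 +
        (L ^ 2 - f ^ 2) * ∑ y ∈ S, ‖entryQuery u φ (some y)‖ ^ 2 ≤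
      (1 + δ) ^ 2 * (f ^ 2 * ∑ o, ‖φ o‖ ^ 2 + (L ^ 2 - f ^ 2) * ∑ y ∈ S, ‖φ (some y)‖ ^ 2) := by
  classical
  have hp : 0 ≤ 8 * ((S.card : ℝ) / N) := by positivity
  set T : Finset (Option (Fin N)) := S.map Function.Embedding.some with hT
  have hTS : ∀ χ : Option (Fin N) → ℂ, ∑ y ∈ S, ‖χ (some y)‖ ^ 2 = ∑ o ∈ T, ‖χ o‖ ^ 2 := by
    intro χ; rw [hT, Finset.sum_map]; rfl
  -- `φ₁` is the part already in `S`, and `φ₂` the part that may leak into it.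
  set φ₁ : Option (Fin N) → ℂ := fun o => if o ∈ T then φ o else 0 with h1
  set φ₂ : Option (Fin N) → ℂ := fun o => if o ∈ T then 0 else φ o with h2
  clear_value T φ₁ φ₂
  have hY : ∑ o, ‖φ₁ o‖ ^ 2 = ∑ o ∈ T, ‖φ o‖ ^ 2 := by
    have : ∀ o, ‖φ₁ o‖ ^ 2 = if o ∈ T then ‖φ o‖ ^ 2 else 0 := by
      intro o; simp only [h1]; split_ifs <;> simp
    simp only [this, Finset.sum_ite_mem, Finset.univ_inter]
  have hXY : ∑ o, ‖φ o‖ ^ 2 = ∑ o, ‖φ₁ o‖ ^ 2 + ∑ o, ‖φ₂ o‖ ^ 2 := by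
    rw [← Finset.sum_add_distrib]
    refine Finset.sum_congr rfl fun o _ => ?_
    simp only [h1, h2]; split_ifs <;> simp
  set x := √(∑ o, ‖φ₂ o‖ ^ 2) with hx
  set y := √(∑ o, ‖φ₁ o‖ ^ 2) with hy
  have hx2 : ∑ o, ‖φ₂ o‖ ^ 2 = x ^ 2 := (Real.sq_sqrt (by positivity)).symm
  have hy2 : ∑ o, ‖φ₁ o‖ ^ 2 = y ^ 2 := (Real.sq_sqrt (by positivity)).symm
  clear_value x y
  have hx0 : 0 ≤ x := hx ▸ Real.sqrt_nonneg _
  have hy0 : 0 ≤ y := hy ▸ Real.sqrt_nonneg _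
  have hL : 0 < L := hf.trans_le hfL
  set ε := √(8 * ((S.card : ℝ) / N)) with hε
  have hε2 : ε ^ 2 = 8 * ((S.card : ℝ) / N) := Real.sq_sqrt hp
  clear_value ε
  have hε0 : 0 ≤ ε := hε ▸ Real.sqrt_nonneg _
  -- The part `φ₁` contributes at most its own norm `y`; the part `φ₂` is damped by `ε`.
  have hb : √(∑ o ∈ T, ‖entryQuery u φ o‖ ^ 2) ≤ y + ε * x := by
    have e : ∀ o, entryQuery u φ o = entryQuery u φ₁ o + entryQuery u φ₂ o := by
      intro o
      rw [← entryQuery_add]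
      congr 1
      funext o'; simp only [h1, h2]; split_ifs <;> simp
    simp only [e]
    refine (sqrt_sum_norm_add_sq_le _ _ _).trans (add_le_add ?_ ?_)
    · rw [hy, ← sum_norm_entryQuery_sq hN u φ₁]
      refine Real.sqrt_le_sqrt (Finset.sum_le_sum_of_subset_of_nonneg (Finset.subset_univ _) ?_)
      intros; positivity
    · rw [hx, hε, ← Real.sqrt_mul hp, ← hTS]
      refine Real.sqrt_le_sqrt (sum_ite_norm_entryQuery_sq_le hN u φ₂ S ?_)
      intro y hyS
      simp [h2, hT, hyS]
  have hb2 : ∑ o ∈ T, ‖entryQuery u φ o‖ ^ 2 ≤ (y + ε * x) ^ 2 := by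
    rw [← Real.sq_sqrt (show 0 ≤ ∑ o ∈ T, ‖entryQuery u φ o‖ ^ 2 by positivity)]
    gcongr
  have hεL : ε * L ≤ δ * f := by
    refine (pow_le_pow_iff_left₀ (by positivity) (by positivity) two_ne_zero).1 ?_
    rw [mul_pow, mul_pow, hε2]; exact hS
  rw [sum_norm_entryQuery_sq hN, hTS, hTS, ← hY, hXY, hx2, hy2]
  have hd : 0 ≤ L ^ 2 - f ^ 2 := by nlinarith
  calc _ ≤ f ^ 2 * (y ^ 2 + x ^ 2) + (L ^ 2 - f ^ 2) * (y + ε * x) ^ 2 := by gcongr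
    _ ≤ (f * x) ^ 2 + (L * y) ^ 2 + 2 * (ε * L) * x * (L * y) + (ε * L) ^ 2 * x ^ 2 := by
      nlinarith [mul_nonneg (mul_nonneg hε0 hx0) hy0, mul_nonneg (sq_nonneg f)
        (mul_nonneg (mul_nonneg hε0 hx0) hy0), mul_nonneg (sq_nonneg f) (sq_nonneg (ε * x))]
    _ ≤ (f * x) ^ 2 + (L * y) ^ 2 + 2 * (δ * f) * x * (L * y) + (δ * f) ^ 2 * x ^ 2 := by gcongr
    -- The cross term is absorbed by AM-GM in the weighted norms `f * x` and `L * y`.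
    _ ≤ (1 + δ) ^ 2 * ((f * x) ^ 2 + (L * y) ^ 2) := by
      nlinarith [mul_nonneg hδ (sq_nonneg (f * x - L * y)), mul_nonneg hδ (sq_nonneg (L * y)),
        mul_nonneg hδ (sq_nonneg (f * x)), mul_nonneg (sq_nonneg δ) (sq_nonneg (L * y))]
    _ = _ := by ring

/-- The weight `h` lies within a factor `μ` above a two-level weight, for which the growth is known.
If `L = f`, that weight is constant and unitarity suffices, without any condition on `S`. -/
lemma weight_entryQuery_le {N : ℕ} (hN : 0 < N) (u : Fin N) (φ : Option (Fin N) → ℂ)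
    (S : Finset (Fin N)) {f L δ μ : ℝ} (hf : 0 < f) (hfL : f ≤ L) (hδ : 0 ≤ δ) (hμ : 1 ≤ μ)
    (hS : L = f ∨ 8 * (S.card / N) * L ^ 2 ≤ δ ^ 2 * f ^ 2) (h : Option (Fin N) → ℝ)
    (hin : ∀ y ∈ S, h (some y) = L) (hout : ∀ o, (∀ y ∈ S, o ≠ some y) → f ≤ h o ∧ h o ≤ μ * f) :
    ∑ o, h o ^ 2 * ‖entryQuery u φ o‖ ^ 2 ≤ (μ * (1 + δ)) ^ 2 * ∑ o, h o ^ 2 * ‖φ o‖ ^ 2 := by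
  classical
  have key : ∀ χ : Option (Fin N) → ℂ,
      f ^ 2 * ∑ o, ‖χ o‖ ^ 2 + (L ^ 2 - f ^ 2) * ∑ y ∈ S, ‖χ (some y)‖ ^ 2 =
        ∑ o, (if o ∈ S.map Function.Embedding.some then L ^ 2 else f ^ 2) * ‖χ o‖ ^ 2 := by
    intro χ
    have e : ∑ y ∈ S, ‖χ (some y)‖ ^ 2 =
        ∑ o, if o ∈ S.map Function.Embedding.some then ‖χ o‖ ^ 2 else 0 := by
      rw [Finset.sum_ite_mem, Finset.univ_inter, Finset.sum_map]; rfl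
    rw [e, Finset.mul_sum, Finset.mul_sum, ← Finset.sum_add_distrib]
    refine Finset.sum_congr rfl fun o _ => ?_
    split_ifs <;> ring
  have hup : ∀ o, h o ^ 2 ≤
      μ ^ 2 * (if o ∈ S.map Function.Embedding.some then L ^ 2 else f ^ 2) := by
    intro o
    split_ifs with ho
    · obtain ⟨y, hy, rfl⟩ := Finset.mem_map.1 ho
      have := hin y hy
      simp only [Function.Embedding.some_apply, this]
      nlinarith [sq_nonneg L, mul_nonneg (sub_nonneg.2 hμ) (sq_nonneg L),
        mul_nonneg (mul_nonneg (sub_nonneg.2 hμ) (sub_nonneg.2 hμ)) (sq_nonneg L)]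
    · have := hout o fun y hy e => ho (Finset.mem_map.2 ⟨y, hy, e.symm⟩)
      rw [← mul_pow]
      exact pow_le_pow_left₀ (hf.le.trans this.1) this.2 2
  have hlo : ∀ o, (if o ∈ S.map Function.Embedding.some then L ^ 2 else f ^ 2) ≤ h o ^ 2 := by
    intro o
    split_ifs with ho
    · obtain ⟨y, hy, rfl⟩ := Finset.mem_map.1 ho
      simp [hin y hy]
    · have := hout o fun y hy e => ho (Finset.mem_map.2 ⟨y, hy, e.symm⟩)
      exact pow_le_pow_left₀ hf.le this.1 2
  have main : ∑ o, (if o ∈ S.map Function.Embedding.some then L ^ 2 else f ^ 2) *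
        ‖entryQuery u φ o‖ ^ 2 ≤ (1 + δ) ^ 2 *
      ∑ o, (if o ∈ S.map Function.Embedding.some then L ^ 2 else f ^ 2) * ‖φ o‖ ^ 2 := by
    rw [← key, ← key]
    rcases hS with rfl | hS
    · simp only [sub_self, zero_mul, add_zero, sum_norm_entryQuery_sq hN]
      exact le_mul_of_one_le_left (by positivity) (one_le_pow₀ (by linarith))
    · exact two_weight_entryQuery_le hN u φ S hf hfL hδ hS
  calc _ ≤ ∑ o, μ ^ 2 * ((if o ∈ S.map Function.Embedding.some then L ^ 2 else f ^ 2) *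
        ‖entryQuery u φ o‖ ^ 2) := by
        refine Finset.sum_le_sum fun o _ => ?_
        rw [← mul_assoc]
        exact mul_le_mul_of_nonneg_right (hup o) (by positivity)
    _ ≤ μ ^ 2 * ((1 + δ) ^ 2 * ∑ o, h o ^ 2 * ‖φ o‖ ^ 2) := by
        rw [← Finset.mul_sum]
        refine mul_le_mul_of_nonneg_left (main.trans ?_) (by positivity)
        gcongr with o
        exact hlo o
    _ = _ := by ring

/-! ### Weighted energies of joint states -/

lemma oracleQuery_update {X W : Type*} {N : ℕ} [DecidableEq X] (ψ : State X N W) (a : AlgBasis X N W)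
    (D : Database X (Fin N)) (o : Option (Fin N)) :
    oracleQuery ψ (a, Function.update D a.1 o) =
      entryQuery a.2.1 (fun o => ψ (a, Function.update D a.1 o)) o := by
  simp [oracleQuery, stdDecomp, phaseQuery, entryQuery, entryDecomp]

section energy

variable {X W : Type*} {N : ℕ} [Fintype X] [DecidableEq X] [Fintype W]

/-- The squared norm of `ψ` after the amplitudes at the database `D` are multiplied by `G D`. -/
def energy (G : Database X (Fin N) → ℝ) (ψ : State X N W) : ℝ :=
  ∑ s : JointBasis X N W, G s.2 ^ 2 * ‖ψ s‖ ^ 2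

lemma sum_norm_unitary_mul_sq {ι : Type*} [Fintype ι] [DecidableEq ι]
    (U : Matrix.unitaryGroup ι ℂ) (v : ι → ℂ) :
    ∑ i, ‖∑ j, (U : Matrix ι ι ℂ) i j * v j‖ ^ 2 = ∑ i, ‖v i‖ ^ 2 := by
  have h : ∀ w : ι → ℂ, ((∑ i, ‖w i‖ ^ 2 : ℝ) : ℂ) = star w ⬝ᵥ w := by
    intro w
    simp only [dotProduct, Pi.star_apply, RCLike.star_def, Complex.conj_mul']
    push_cast; rfl
  apply Complex.ofReal_injective
  change ((∑ i, ‖((U : Matrix ι ι ℂ).mulVec v) i‖ ^ 2 : ℝ) : ℂ) = _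
  rw [h, h, Matrix.star_mulVec, Matrix.dotProduct_mulVec, Matrix.vecMul_vecMul,
    ← Matrix.star_eq_conjTranspose, Matrix.UnitaryGroup.star_mul_self, Matrix.vecMul_one]

lemma energy_applyLocal [DecidableEq W] (G : Database X (Fin N) → ℝ) (U : Matrix.unitaryGroup (AlgBasis X N W) ℂ)
    (ψ : State X N W) : energy G (applyLocal U ψ) = energy G ψ := by
  simp only [energy, Fintype.sum_prod_type_right (α₁ := AlgBasis X N W), ← Finset.mul_sum]
  refine Finset.sum_congr rfl fun D _ => ?_
  congr 1
  exact sum_norm_unitary_mul_sq U fun a => ψ (a, D)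

lemma sum_database_eq (x : X) (F : Database X (Fin N) → ℝ) :
    ∑ D, F D = ∑ D : Database X (Fin N) with D x = none, ∑ o, F (Function.update D x o) := by
  rw [Finset.sum_sigma']
  refine Finset.sum_bij' (fun D _ => ⟨Function.update D x none, D x⟩)
    (fun p _ => Function.update p.1 x p.2) ?_ ?_ ?_ ?_ ?_
  · intro D _; simp
  · intro p _; simp
  · intro D _; simp
  · rintro ⟨D, o⟩ hp
    have hD : D x = none := by simpa using hp
    have : Function.update D x none = D := by rw [← hD, Function.update_eq_self]
    simp [this]
  · intro D _; simp

/-- For fixed registers of the algorithm and fixed other entries, the oracle acts on one entry only,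
so a bound per entry sums to a global one. -/
lemma energy_oracleQuery_le (G : Database X (Fin N) → ℝ) (c : ℝ)
    (hG : ∀ (D : Database X (Fin N)) (x : X) (u : Fin N) (φ : Option (Fin N) → ℂ), D x = none →
      ∑ o, G (Function.update D x o) ^ 2 * ‖entryQuery u φ o‖ ^ 2 ≤
        c * ∑ o, G (Function.update D x o) ^ 2 * ‖φ o‖ ^ 2) (ψ : State X N W) :
    energy G (oracleQuery ψ) ≤ c * energy G ψ := by
  simp only [energy, Fintype.sum_prod_type (α₁ := AlgBasis X N W)]
  rw [Finset.mul_sum]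
  refine Finset.sum_le_sum fun a _ => ?_
  rw [sum_database_eq a.1, sum_database_eq a.1, Finset.mul_sum]
  refine Finset.sum_le_sum fun D hD => ?_
  simp only [oracleQuery_update]
  exact hG D a.1 a.2.1 _ (Finset.mem_filter.1 hD).2

lemma energy_initialState [DecidableEq W] (G : Database X (Fin N) → ℝ) (A : QueryAlgorithm X N W) :
    energy G (initialState A) = G (emptyDB X (Fin N)) ^ 2 := by
  have h : ∑ a, ‖A.init a‖ ^ 2 = 1 := by
    rw [← EuclideanSpace.norm_sq_eq, A.norm_init, one_pow]
  simp only [energy, Fintype.sum_prod_type_right (α₁ := AlgBasis X N W), ← Finset.mul_sum]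
  rw [Finset.sum_eq_single (emptyDB X (Fin N))]
  · simp [initialState, h]
  · intro D _ hD; simp [initialState, hD]
  · simp

lemma energy_stateAfter_le [DecidableEq W] (G : Database X (Fin N) → ℝ) {c : ℝ} (hc : 0 ≤ c)
    (hG : ∀ (D : Database X (Fin N)) (x : X) (u : Fin N) (φ : Option (Fin N) → ℂ), D x = none →
      ∑ o, G (Function.update D x o) ^ 2 * ‖entryQuery u φ o‖ ^ 2 ≤
        c * ∑ o, G (Function.update D x o) ^ 2 * ‖φ o‖ ^ 2) (A : QueryAlgorithm X N W) (q : ℕ) :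
    energy G (stateAfter A q) ≤ c ^ q * G (emptyDB X (Fin N)) ^ 2 := by
  induction q with
  | zero => simp [stateAfter, energy_initialState]
  | succ q ih =>
    calc energy G (stateAfter A (q + 1))
        ≤ c * energy G (applyLocal (A.localU q) (stateAfter A q)) := energy_oracleQuery_le G c hG _
      _ ≤ c * (c ^ q * G (emptyDB X (Fin N)) ^ 2) := by
          rw [energy_applyLocal]; gcongr
      _ = _ := by ring

lemma energy_mono {G G' : Database X (Fin N) → ℝ} (h : ∀ D, G D ^ 2 ≤ G' D ^ 2)
    (ψ : State X N W) : energy G ψ ≤ energy G' ψ :=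
  Finset.sum_le_sum fun s _ => mul_le_mul_of_nonneg_right (h s.2) (by positivity)

open Classical in
lemma winProb_eq_energy [DecidableEq W] (A : QueryAlgorithm X N W) (q : ℕ) (Q : Set (Database X (Fin N))) :
    winProb A q Q = energy (fun D => if D ∈ Q then 1 else 0) (stateAfter A q) := by
  rw [← energy_applyLocal _ A.finalU, winProb, EuclideanSpace.norm_sq_eq, energy]
  refine Finset.sum_congr rfl fun s _ => ?_
  simp only [project]
  split_ifs <;> simp

/-- A Markov inequality for the weighted norm. -/
lemma winProb_mul_le [DecidableEq W] (A : QueryAlgorithm X N W) (q : ℕ) (Q : Set (Database X (Fin N)))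
    (G : Database X (Fin N) → ℝ) {B : ℝ} (hB : 0 ≤ B) (hQ : ∀ D ∈ Q, B ≤ G D) :
    winProb A q Q * B ^ 2 ≤ energy G (stateAfter A q) := by
  classical
  refine le_trans (le_of_eq ?_) (energy_mono (G := fun D => if D ∈ Q then B else 0) ?_ _)
  · rw [winProb_eq_energy, energy, energy, Finset.sum_mul]
    refine Finset.sum_congr rfl fun s _ => ?_
    split_ifs <;> simp [mul_comm]
  · intro D
    split_ifs with h
    · exact pow_le_pow_left₀ hB (hQ D h) 2
    · simpa using sq_nonneg (G D)

lemma winProb_zero [DecidableEq W] (A : QueryAlgorithm X N W) (Q : Set (Database X (Fin N)))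
    (hQ : emptyDB X (Fin N) ∉ Q) : winProb A 0 Q = 0 := by
  simp [winProb_eq_energy, stateAfter, energy_initialState, hQ]

end energy

/-! ### The weight of a database on salted inputs -/

lemma size_update_some {X Y : Type*} [Fintype X] [DecidableEq X] (D : Database X Y) (x : X) (y : Y)
    (hx : D x = none) : size (Function.update D x (some y)) = size D + 1 := by
  have h : (Finset.univ.filter fun x' => (Function.update D x (some y) x').isSome = true) =
      insert x (Finset.univ.filter fun x' => (D x').isSome = true) := by
    ext x'
    by_cases e : x' = x
    · subst e; simp
    · simp [e]
  rw [size, size, h, Finset.card_insert_of_notMem (by simp [hx])]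

lemma contained_update_some {X Y : Type*} [DecidableEq X] (D : Database X Y) (x : X) (y : Y)
    (hx : D x = none) : Contained D (Function.update D x (some y)) := by
  intro x' y' h
  rw [Function.update_of_ne]
  · exact h
  · rintro rfl; simp [hx] at h

open Classical in
/-- The weight of a database: `L` on `P`, and `exp (|D| / T)`, capped at `L`, outside `P`. -/
def saltWeight {X Y : Type*} [Fintype X] (P : Set (Database X Y)) (T L : ℝ) (D : Database X Y) :
    ℝ :=
  if D ∈ P then L else min (Real.exp (size D / T)) L

lemma saltWeight_entryQuery_le {X : Type*} [Fintype X] [DecidableEq X] {N : ℕ} (hN : 0 < N)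
    (P : Set (Database X (Fin N))) (hP : IsMonotone P) {T L : ℝ} (hT : 0 < T) (hL : 0 < L)
    (D : Database X (Fin N)) (x : X) (hx : D x = none)
    (hD : D ∉ P → 8 * ((Set.ncard {y | Function.update D x (some y) ∈ P} : ℝ) / N) * L ^ 2 ≤
      (1 / T) ^ 2 * Real.exp (size D / T) ^ 2) (u : Fin N) (φ : Option (Fin N) → ℂ) :
    ∑ o, saltWeight P T L (Function.update D x o) ^ 2 * ‖entryQuery u φ o‖ ^ 2 ≤
      (Real.exp (1 / T) * (1 + 1 / T)) ^ 2 *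
        ∑ o, saltWeight P T L (Function.update D x o) ^ 2 * ‖φ o‖ ^ 2 := by
  classical
  have hμ : 1 ≤ Real.exp (1 / T) := Real.one_le_exp (by positivity)
  have hnone : Function.update D x none = D := by rw [← hx, Function.update_eq_self]
  by_cases hDP : D ∈ P
  -- By monotonicity, the weight is the constant `L` along the whole entry.
  · have hall : ∀ o, Function.update D x o ∈ P := by
      intro o
      cases o with
      | none => rwa [hnone]
      | some y => exact hP _ _ hDP (contained_update_some D x y hx)
    refine weight_entryQuery_le hN u φ ∅ hL le_rfl (by positivity) hμ (Or.inl rfl) _ (by simp) ?_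
    intro o _
    simp only [saltWeight, hall o, if_true, le_refl, true_and]
    exact le_mul_of_one_le_left hL.le hμ
  · set f := min (Real.exp (size D / T)) L with hf
    have hf0 : 0 < f := lt_min (Real.exp_pos _) hL
    refine weight_entryQuery_le hN u φ
      (Finset.univ.filter fun y => Function.update D x (some y) ∈ P) (f := f) (L := L) hf0
      (min_le_right _ _) (by positivity) hμ ?_ _ ?_ ?_
    -- Once the cap is reached, entering `P` gains no weight, so the transition bound is needed only
    -- below the cap.
    · rcases le_total L (Real.exp (size D / T)) with h | h
      · left; rw [hf, min_eq_right h]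
      · right
        rw [hf, min_eq_left h]
        have e := hD hDP
        rwa [Set.ncard_eq_toFinset_card', Set.toFinset_ofPred] at e
    · intro y hy
      simp [saltWeight, (Finset.mem_filter.1 hy).2]
    · intro o ho
      cases o with
      | none =>
        rw [hnone, saltWeight, if_neg hDP]
        exact ⟨le_rfl, le_mul_of_one_le_left hf0.le hμ⟩
      | some y =>
        have hy : Function.update D x (some y) ∉ P := fun h => ho y (by simp [h]) rfl
        have e : Real.exp ((size D + 1 : ℕ) / T) =
            Real.exp (1 / T) * Real.exp (size D / T) := by
          rw [← Real.exp_add]; push_cast; ring_nf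
        rw [saltWeight, if_neg hy, size_update_some D x y hx, e]
        constructor
        · exact min_le_min_right _ (le_mul_of_one_le_left (Real.exp_pos _).le hμ)
        · rw [hf, mul_min_of_nonneg _ _ (zero_le_one.trans hμ)]
          exact min_le_min_left _ (le_mul_of_one_le_left hL.le hμ)

/-! ### Products of weights over the salts -/

lemma restrict_update_self {K X Y : Type*} [DecidableEq K] [DecidableEq X]
    (D : Database (K × X) Y) (k : K) (x : X) (o : Option Y) :
    restrict (Function.update D (k, x) o) k = Function.update (restrict D k) x o := by
  funext x'
  by_cases h : x' = x
  · subst h; simp [restrict]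
  · simp [restrict, Function.update_of_ne, h]

lemma restrict_update_of_ne {K X Y : Type*} [DecidableEq K] [DecidableEq X]
    (D : Database (K × X) Y) {k k' : K} (hk : k' ≠ k) (x : X) (o : Option Y) :
    restrict (Function.update D (k, x) o) k' = restrict D k' := by
  funext x'
  simp [restrict, Function.update_of_ne, hk]

lemma prod_weight_entryQuery_le {K X : Type*} [Fintype K] [DecidableEq K] [DecidableEq X] {N : ℕ}
    (g : Database X (Fin N) → ℝ) (c : ℝ)
    (hg : ∀ (D : Database X (Fin N)) (x : X) (u : Fin N) (φ : Option (Fin N) → ℂ), D x = none →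
      ∑ o, g (Function.update D x o) ^ 2 * ‖entryQuery u φ o‖ ^ 2 ≤
        c * ∑ o, g (Function.update D x o) ^ 2 * ‖φ o‖ ^ 2)
    (D : Database (K × X) (Fin N)) (x : K × X) (u : Fin N) (φ : Option (Fin N) → ℂ)
    (hx : D x = none) :
    ∑ o, (∏ k, g (restrict (Function.update D x o) k)) ^ 2 * ‖entryQuery u φ o‖ ^ 2 ≤
      c * ∑ o, (∏ k, g (restrict (Function.update D x o) k)) ^ 2 * ‖φ o‖ ^ 2 := by
  obtain ⟨k, x⟩ := x
  have h : ∀ o, (∏ k', g (restrict (Function.update D (k, x) o) k')) ^ 2 =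
      (∏ k' ∈ Finset.univ.erase k, g (restrict D k')) ^ 2 *
        g (Function.update (restrict D k) x o) ^ 2 := by
    intro o
    rw [← Finset.prod_erase_mul _ _ (Finset.mem_univ k), restrict_update_self, mul_pow]
    congr 2
    exact Finset.prod_congr rfl fun k' hk' => by
      rw [restrict_update_of_ne D (Finset.ne_of_mem_erase hk')]
  simp only [h, mul_assoc, ← Finset.mul_sum]
  rw [mul_left_comm]
  exact mul_le_mul_of_nonneg_left (hg (restrict D k) x u φ hx) (by positivity)

/-- A query bound for direct products: the transition probabilities of `P` are at most
`K q exp (2 |D| / T)`. -/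
lemma winProb_directProduct_le {X W : Type*} [Fintype X] [DecidableEq X] [Fintype W] [DecidableEq W]
    {N : ℕ} (hN : 0 < N) (P : Set (Database X (Fin N))) (hP : IsMonotone P)
    (h0 : emptyDB X (Fin N) ∉ P) {K q : ℝ} (hK : 0 < K) (hq : 0 < q) (κ T : ℕ) (hT : 0 < T)
    (hD : ∀ (D : Database X (Fin N)) (x : X), D ∉ P → D x = none →
      (Set.ncard {y | Function.update D x (some y) ∈ P} : ℝ) / N ≤
        K * q * Real.exp (size D / T) ^ 2)
    (A : QueryAlgorithm (Fin κ × X) N W) :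
    winProb A (κ * T) (directProduct κ P) ≤ (8 * K * Real.exp 4 * (T ^ 2 * q)) ^ κ := by
  have hT' : (0 : ℝ) < T := by exact_mod_cast hT
  set R : ℝ := 8 * K * q with hR
  have hR0 : 0 < R := by positivity
  -- Chosen so that `R * L ^ 2 = (1 / T) ^ 2`: a jump into `P` then costs a relative growth `δ = 1 /
  -- T`, no more in order than that of the size factor.
  set L : ℝ := 1 / (T * √R) with hL
  have hL0 : 0 < L := by positivity
  have hL2 : R * L ^ 2 = (1 / T) ^ 2 := by
    rw [hL, div_pow, mul_pow, Real.sq_sqrt hR0.le]; field_simp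
  set g := saltWeight P (T : ℝ) L with hg
  set G : Database (Fin κ × X) (Fin N) → ℝ := fun D => ∏ k, g (restrict D k) with hG
  set μ : ℝ := Real.exp (1 / T) * (1 + 1 / T) with hμ
  have hμ0 : 0 ≤ μ := by positivity
  have step : ∀ (D : Database X (Fin N)) (x : X) (u : Fin N) (φ : Option (Fin N) → ℂ),
      D x = none → ∑ o, g (Function.update D x o) ^ 2 * ‖entryQuery u φ o‖ ^ 2 ≤
        μ ^ 2 * ∑ o, g (Function.update D x o) ^ 2 * ‖φ o‖ ^ 2 := by
    intro D x u φ hx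
    refine saltWeight_entryQuery_le hN P hP hT' hL0 D x hx (fun hDP => ?_) u φ
    calc _ ≤ 8 * (K * q * Real.exp (size D / T) ^ 2) * L ^ 2 := by
          gcongr; exact hD D x hDP hx
      _ = R * L ^ 2 * Real.exp (size D / T) ^ 2 := by rw [hR]; ring
      _ = _ := by rw [hL2]
  have h1 := energy_stateAfter_le G (sq_nonneg μ)
    (fun D x u φ hx => prod_weight_entryQuery_le g _ step D x u φ hx) A (κ * T)
  -- The cap keeps this valid even when `L < 1`.
  have hempty : G (emptyDB (Fin κ × X) (Fin N)) ^ 2 ≤ 1 := by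
    have e : ∀ k : Fin κ, g (restrict (emptyDB (Fin κ × X) (Fin N)) k) = min 1 L := by
      intro k
      have e1 : restrict (emptyDB (Fin κ × X) (Fin N)) k = emptyDB X (Fin N) := rfl
      have e2 : size (emptyDB X (Fin N)) = 0 := by simp [size, emptyDB]
      rw [e1, hg, saltWeight, if_neg h0, e2]; simp
    have h2 : 0 ≤ min 1 L := le_min zero_le_one hL0.le
    simp only [hG, e, Finset.prod_const]
    exact pow_le_one₀ (by positivity) (pow_le_one₀ h2 (min_le_left _ _))
  have h2 := winProb_mul_le A (κ * T) (directProduct κ P) G (B := L ^ κ) (by positivity) (by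
    intro D hDQ
    have e : ∀ k : Fin κ, g (restrict D k) = L := fun k => by
      rw [hg, saltWeight, if_pos (hDQ k)]
    simp [hG, e])
  have hμT : μ ^ T ≤ Real.exp 2 := by
    have e : μ ≤ Real.exp (2 / T) := by
      calc μ ≤ Real.exp (1 / T) * Real.exp (1 / T) := by
            rw [hμ]; gcongr; linarith [Real.add_one_le_exp (1 / (T : ℝ))]
        _ = Real.exp (2 / T) := by rw [← Real.exp_add]; ring_nf
    calc μ ^ T ≤ Real.exp (2 / T) ^ T := by gcongr
      _ = Real.exp 2 := by rw [← Real.exp_nat_mul]; congr 1; field_simp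
  have h3 : (μ ^ 2) ^ (κ * T) ≤ Real.exp 4 ^ κ := by
    calc (μ ^ 2) ^ (κ * T) = ((μ ^ T) ^ 2) ^ κ := by
          rw [← pow_mul, ← pow_mul, ← pow_mul]; congr 1; ring
      _ ≤ (Real.exp 2 ^ 2) ^ κ := by gcongr
      _ = Real.exp 4 ^ κ := by rw [← Real.exp_nat_mul]; norm_num
  have h4 : winProb A (κ * T) (directProduct κ P) * (L ^ κ) ^ 2 ≤ Real.exp 4 ^ κ :=
    h2.trans (h1.trans ((mul_le_of_le_one_right (by positivity) hempty).trans h3))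
  have h5 : (8 * K * Real.exp 4 * (T ^ 2 * q)) ^ κ * (L ^ κ) ^ 2 = Real.exp 4 ^ κ := by
    rw [← pow_mul, mul_comm κ 2, pow_mul, ← mul_pow]
    congr 1
    calc _ = R * L ^ 2 * T ^ 2 * Real.exp 4 := by rw [hR]; ring
      _ = _ := by rw [hL2]; field_simp
  rw [← h5] at h4
  exact le_of_mul_le_mul_right h4 (by positivity)

/-! ### Transition probabilities -/

lemma size_lt_card {X Y : Type*} [Fintype X] {D : Database X Y} {x : X} (hx : D x = none) :
    size D < Fintype.card X := by
  refine Finset.card_lt_univ_of_notMem (x := x) ?_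
  simp [hx]

section transition

variable {X Y : Type*} [Fintype X] [DecidableEq X] [Fintype Y]

lemma ncard_div_card_le_one (S : Set Y) : (S.ncard : ℝ) / (Fintype.card Y : ℝ) ≤ 1 := by
  refine div_le_one_of_le₀ ?_ (Nat.cast_nonneg _)
  rw [← Nat.card_eq_fintype_card]
  exact_mod_cast Set.ncard_le_card S

lemma ncard_div_card_le_transitionProb (P : Set (Database X Y)) {D : Database X Y} {x : X} {ν : ℕ}
    (hD : D ∉ P) (hν : size D ≤ ν) (hx : D x = none) :
    (Set.ncard {y : Y | Function.update D x (some y) ∈ P} : ℝ) / (Fintype.card Y : ℝ) ≤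
      transitionProb P ν := by
  refine le_csSup ⟨1, ?_⟩ ⟨D, x, hD, hν, hx, rfl⟩
  rintro _ ⟨D, x, -, -, -, rfl⟩
  exact ncard_div_card_le_one _

lemma transitionProb_nonneg (P : Set (Database X Y)) (ν : ℕ) : 0 ≤ transitionProb P ν := by
  refine Real.sSup_nonneg ?_
  rintro _ ⟨D, x, -, -, -, rfl⟩
  positivity

end transition

lemma rpow_le_factorial_mul_exp {c x : ℝ} (hx : 1 ≤ x) :
    x ^ c ≤ (⌈c⌉₊.factorial : ℝ) * Real.exp x := by
  have h1 : x ^ c ≤ x ^ ⌈c⌉₊ := by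
    rw [← Real.rpow_natCast]
    exact Real.rpow_le_rpow_of_exponent_le hx (Nat.le_ceil c)
  have h2 := Real.pow_div_factorial_le_exp x (zero_le_one.trans hx) ⌈c⌉₊
  rw [div_le_iff₀ (by positivity), mul_comm] at h2
  exact h1.trans h2

/-- The transition probabilities beyond `T` grow at most exponentially on the scale `T`. -/
lemma IsPolynomial.ncard_div_le {M N : ℕ} {P : Set (Database (Fin M) (Fin N))} {c₁ c₂ a b : ℝ}
    {t₀ : ℕ} (ha : 0 < a) (hb : 0 < b) (hpoly : IsPolynomial P c₁ c₂ a b t₀) {T : ℕ} (hT : 0 < T)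
    (hT₀ : t₀ ≤ T) {D : Database (Fin M) (Fin N)} {x : Fin M} (hD : D ∉ P) (hx : D x = none) :
    (Set.ncard {y | Function.update D x (some y) ∈ P} : ℝ) / N ≤
      (1 + 1 / a + b / a * ⌈c₁⌉₊.factorial) * transitionProb P T *
        Real.exp (size D / T) ^ 2 := by
  have hT' : (0 : ℝ) < T := by exact_mod_cast hT
  have hp := transitionProb_nonneg P T
  set p := transitionProb P T with hpdef
  set E := Real.exp (size D / T) with hE
  have hE1 : 1 ≤ E := Real.one_le_exp (by positivity)
  have hE2 : 1 ≤ E ^ 2 := one_le_pow₀ hE1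
  set B : ℝ := ((⌈c₁⌉₊.factorial : ℕ) : ℝ) with hB
  have hB0 : 0 ≤ B := Nat.cast_nonneg _
  set r : ℝ := (Set.ncard {y | Function.update D x (some y) ∈ P} : ℝ) / N with hr
  have hrt : ∀ ν, size D ≤ ν → r ≤ transitionProb P ν := fun ν hν => by
    simpa using ncard_div_card_le_transitionProb P hD hν hx
  -- The three summands serve three cases: `|D| ≤ T`; the lower bound on `p_T` capped at `1`; and
  -- polynomial growth from `T` to `|D|`.
  have expand : (1 + 1 / a + b / a * B) * p * E ^ 2 =
      p * E ^ 2 + p / a * E ^ 2 + b / a * B * p * E ^ 2 := by ring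
  have t1 : p ≤ p * E ^ 2 := le_mul_of_one_le_right hp hE2
  have t2 : p / a ≤ p / a * E ^ 2 := le_mul_of_one_le_right (by positivity) hE2
  have t3 : 0 ≤ b / a * B * p * E ^ 2 := by positivity
  have t4 : 0 ≤ p / a := by positivity
  rw [expand]
  rcases le_or_gt (size D) T with hDT | hDT
  · linarith [hrt T hDT]
  -- As `T < |D| < M`, the polynomial bounds hold both at `T` and at `|D|`.
  have hDM : size D < M := by simpa using size_lt_card hx
  have hlow := (hpoly T hT₀ (hDT.trans hDM)).1
  have hup := (hrt _ le_rfl).trans (hpoly (size D) (hT₀.trans hDT.le) hDM).2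
  rcases le_or_gt 1 ((T : ℝ) ^ c₁ / (N : ℝ) ^ c₂) with h1 | h1
  · rw [min_eq_left h1, mul_one] at hlow
    have hr1 : r ≤ 1 := by
      simpa using ncard_div_card_le_one {y : Fin N | Function.update D x (some y) ∈ P}
    have : 1 ≤ p / a := (one_le_div ha).2 hlow
    linarith [mul_nonneg hp (sq_nonneg E)]
  · rw [min_eq_right h1.le, ← le_div_iff₀' ha] at hlow
    have hx1 : (1 : ℝ) ≤ size D / T := (one_le_div hT').2 (by exact_mod_cast hDT.le)
    have e : (size D : ℝ) ^ c₁ = (size D / T : ℝ) ^ c₁ * (T : ℝ) ^ c₁ := by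
      rw [Real.div_rpow (Nat.cast_nonneg _) hT'.le, div_mul_cancel₀]
      exact (Real.rpow_pos_of_pos hT' _).ne'
    have h2 : (size D / T : ℝ) ^ c₁ ≤ B * E := rpow_le_factorial_mul_exp hx1
    have h3 : r ≤ b * ((B * E) * (p / a)) := by
      refine hup.trans ?_
      rw [e, mul_div_assoc]
      gcongr
    have h4 : b * ((B * E) * (p / a)) ≤ b / a * B * p * E ^ 2 := by
      have : b * ((B * E) * (p / a)) = b / a * B * p * E := by ring
      rw [this]
      exact mul_le_mul_of_nonneg_left (by nlinarith) (by positivity)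
    linarith [mul_nonneg hp (sq_nonneg E)]

end CompressedOracle

end

/-! ### The constant and the limit of the query bound -/

theorem mainTheorem5 (c₁ c₂ : ℝ) (hc₁ : 0 ≤ c₁) (hc₂ : 0 ≤ c₂)
    (a b g₁ g₂ : ℝ) (ha : 0 < a) (hb : 0 < b) (hg₁ : 0 < g₁) (hg₂ : 0 < g₂) (t₀ : ℕ) :
    ∃ C : ℝ, 0 < C ∧
      ∀ (M N : ℕ), 0 < M → 0 < N →
      ∀ P : Set (CompressedOracle.Database (Fin M) (Fin N)),
        CompressedOracle.IsMonotone P →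
        CompressedOracle.emptyDB (Fin M) (Fin N) ∉ P →
        CompressedOracle.IsPolynomial P c₁ c₂ a b t₀ →
      ∀ (κ T : ℕ), 0 < κ → t₀ ≤ T →
      ∀ γ : ℝ,
        g₁ * ((T : ℝ) ^ 2 * CompressedOracle.transitionProb P T) ≤ γ →
        γ ≤ g₂ * ((T : ℝ) ^ 2 * CompressedOracle.transitionProb P T) →
      ∀ (W : Type) [Fintype W] [DecidableEq W]
        (A : CompressedOracle.QueryAlgorithm (Fin κ × Fin M) N W),
        CompressedOracle.winProb A (κ * T) (CompressedOracle.directProduct κ P)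
          ≤ C ^ κ * γ ^ κ := by
  set K : ℝ := 1 + 1 / a + b / a * ⌈c₁⌉₊.factorial with hK
  have hK0 : 0 < K := by positivity
  refine ⟨8 * K * Real.exp 4 / g₁, by positivity, ?_⟩
  intro M N _ hN P hP h0 hpoly κ T hκ hT₀ γ hγ₁ hγ₂ W _ _ A
  -- For `T = 0` the scale `1 / T` is meaningless; no query is made and the empty database fails at
  -- some salt, as `κ > 0`.
  rcases Nat.eq_zero_or_pos T with rfl | hT
  · have hγ : γ = 0 := by
      refine le_antisymm (by simpa using hγ₂) (by simpa using hγ₁)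
    rw [mul_zero, CompressedOracle.winProb_zero, hγ, zero_pow hκ.ne', mul_zero]
    exact fun h => h0 (h ⟨0, hκ⟩)
  have hp := CompressedOracle.transitionProb_nonneg P T
  set p := CompressedOracle.transitionProb P T with hpdef
  -- The choice of `L` needs a positive transition bound, while `p` may vanish; the case of `p`
  -- itself follows by letting `q` tend to `p` from above.
  have hbound : ∀ q, p < q →
      CompressedOracle.winProb A (κ * T) (CompressedOracle.directProduct κ P) ≤
        (8 * K * Real.exp 4 * (T ^ 2 * q)) ^ κ := by
    intro q hq
    refine CompressedOracle.winProb_directProduct_le hN P hP h0 hK0 (hp.trans_lt hq) κ T hT ?_ A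
    intro D x hD hx
    refine (hpoly.ncard_div_le ha hb hT hT₀ hD hx).trans ?_
    gcongr
  have hlim : CompressedOracle.winProb A (κ * T) (CompressedOracle.directProduct κ P) ≤
      (8 * K * Real.exp 4 * (T ^ 2 * p)) ^ κ := by
    have hcont : Continuous fun q : ℝ => (8 * K * Real.exp 4 * ((T : ℝ) ^ 2 * q)) ^ κ := by
      fun_prop
    refine ge_of_tendsto (hcont.continuousWithinAt (s := Set.Ioi p)) ?_
    filter_upwards [self_mem_nhdsWithin] with q hq using hbound q hq
  refine hlim.trans ?_
  rw [← mul_pow]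
  refine pow_le_pow_left₀ (by positivity) ?_ κ
  rw [div_mul_eq_mul_div, le_div_iff₀ hg₁, mul_assoc _ _ g₁]
  refine mul_le_mul_of_nonneg_left ?_ (by positivity)
  linarith
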